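/- \textbf{Setting.} A set-valued operator $A\colon\mathcal E\to 2^{\mathcal E}$ on a real Hilbert space is maximally monotone if $\langle x-y\mid u-v\rangle\ge 0$ whenever $u\in Ax$ and $v\in Ay$, and no operator with a strictly larger graph has this property; $A^{-1}u=\{x : u\in Ax\}$, and $J_A=(\mathrm{Id}+A)^{-1}$ is its resolvent, which is then single-valued and defined everywhere. Let $m,K\ge 1$ be integers, and let $\mathcal H_1,\dots,\mathcal H_m$ and $\mathcal G_1,\dots,\mathcal G_K$ be real Hilbert spaces. For all $i\in\{1,\dots,m\}$ and $k\in\{1,\dots,K\}$ let $A_i\colon\mathcal H_i\to 2^{\mathcal H_i}$ and $B_k\colon\mathcal G_k\to 2^{\mathcal G_k}$ be maximally monotone, $z_i\in\mathcal H_i$, $r_k\in\mathcal G_k$, and let $L_{ki}\colon\mathcal H_i\to\mathcal G_k$ be linear and bounded. On the product spaces $\mathcal H=\prod_i\mathcal H_i$ and $\mathcal G=\prod_k\mathcal G_k$ set $z=(z_i)_i$, $r=(r_k)_k$, $Lx=\big(\sum_{i}L_{ki}x_i\big)_k$ and $L^*v^*=\big(\sum_{k}L_{ki}^*v^*_k\big)_i$.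 Let $\mathscr P$ be the set of $\bar x\in\mathcal H$ such that $$z\in \prod_{i=1}^m A_i\bar x_i+L^*\Big(\prod_{k=1}^K B_k\Big(\sum_{j=1}^m L_{kj}\bar x_j-r_k\Big)\Big)\quad\text{in }\mathcal H,$$ let $\mathscr D$ be the set of $\bar v^*\in\mathcal G$ such that $$-r\in -L\Big(\prod_{i=1}^m A_i^{-1}\Big(z_i-\sum_{l=1}^K L_{li}^*\bar v^*_l\Big)\Big)+\prod_{k=1}^K B_k^{-1}\bar v^*_k\quad\text{in }\mathcal G,$$ and let $\mathbf Z$ (the Kuhn--Tucker set) be the set of $(x,v^*)\in\mathcal H\times\mathcal G$ such that $z_i-\sum_k L_{ki}^*v_k^*\in A_ix_i$ for every $i$ and $\sum_i L_{ki}x_i-r_k\in B_k^{-1}v_k^*$ for every $k$. (Thus the inclusions that define $\mathscr P$ share the same elements of the sets $B_k(\cdot)$, and those that define $\mathscr D$ share the same elements of the sets $A_i^{-1}(\cdot)$.) \textbf{Algorithm.} Let $\varepsilon\in{]0,1[}$, $x_{i,0}\in\mathcal H_i$ and $v^*_{k,0}\in\mathcal G_k$ be arbitrary, and let $\gamma_n,\mu_n\in[\varepsilon,1/\varepsilon]$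 and $\lambda_n\in[\varepsilon,2-\varepsilon]$ be arbitrary. For $n=0,1,\dots$ compute, for all $i$ and $k$, $$\begin{aligned} a_{i,n}&=J_{\gamma_nA_i}\Big(x_{i,n}+\gamma_n\Big(z_i-\sum_{k=1}^K L_{ki}^*v^*_{k,n}\Big)\Big),\\ l_{k,n}&=\sum_{i=1}^m L_{ki}x_{i,n},\qquad b_{k,n}=r_k+J_{\mu_nB_k}\big(l_{k,n}+\mu_nv^*_{k,n}-r_k\big),\qquad t_{k,n}=b_{k,n}-\sum_{i=1}^m L_{ki}a_{i,n},\\ s^*_{i,n}&=\gamma_n^{-1}(x_{i,n}-a_{i,n})+\mu_n^{-1}\sum_{k=1}^K L_{ki}^*(l_{k,n}-b_{k,n}),\qquad \tau_n=\sum_{i=1}^m\|s^*_{i,n}\|^2+\sum_{k=1}^K\|t_{k,n}\|^2. \end{aligned}$$ If $\tau_n=0$, return $\bar x_i=a_{i,n}$ and $\bar v^*_k=v^*_{k,n}+\mu_n^{-1}(l_{k,n}-b_{k,n})$ for all $i,k$, and terminate. If $\tau_n>0$, set $$\theta_n=\frac{\lambda_n}{\tau_n}\Big(\gamma_n^{-1}\sum_{i=1}^m\|x_{i,n}-a_{i,n}\|^2+\mu_n^{-1}\sum_{k=1}^K\|l_{k,n}-b_{k,n}\|^2\Big),\quad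 x_{i,n+1}=x_{i,n}-\theta_ns^*_{i,n},\quad v^*_{k,n+1}=v^*_{k,n}-\theta_nt_{k,n}.$$ \textbf{Theorem.} Suppose that $\mathscr P\ne\varnothing$. Then either the algorithm terminates after finitely many iterations and returns a point $(\bar x_1,\dots,\bar x_m,\bar v^*_1,\dots,\bar v^*_K)\in\mathbf Z$, or $\tau_n>0$ for every $n\in\mathbb N$ and the following hold. \begin{enumerate} \item For every $i$: $\sum_n\|s^*_{i,n}\|^2<+\infty$, $\sum_n\|x_{i,n+1}-x_{i,n}\|^2<+\infty$ and $\sum_n\|x_{i,n}-a_{i,n}\|^2<+\infty$. \item For every $k$: $\sum_n\|t_{k,n}\|^2<+\infty$, $\sum_n\|v^*_{k,n+1}-v^*_{k,n}\|^2<+\infty$ and $\sum_n\big\|\sum_{i}L_{ki}x_{i,n}-b_{k,n}\big\|^2<+\infty$. \item There are $\bar x\in\mathscr P$ and $\bar v^*\in\mathscr D$ with $(\bar x,\bar v^*)\in\mathbf Z$ such that, for every $i$ and $k$, $(x_{i,n})_n$ converges weakly to $\bar x_i$ and $(v^*_{k,n})_n$ converges weakly to $\bar v^*_k$. \end{enumerate}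 -/

import Mathlib

open Filter Topology
open scoped Pointwise

namespace MonotoneInclusion

/-! ## Set-valued operators on a real Hilbert space -/

section Operators

/-- The graph of a set-valued operator. -/
def gra {E : Type*} (A : E → Set E) : Set (E × E) :=
  {p | p.2 ∈ A p.1}

/-- The inverse of a set-valued operator. -/
def invOp {E : Type*} (A : E → Set E) : E → Set E :=
  fun u => {x | u ∈ A x}

/-- Monotonicity of a set-valued operator. -/
def IsMonotone {E : Type*} [NormedAddCommGroup E] [InnerProductSpace ℝ E]
    (A : E → Set E) : Prop :=
  ∀ p ∈ gra A, ∀ q ∈ gra A, 0 ≤ inner ℝ (p.1 - q.1) (p.2 - q.2)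

/-- Maximal monotonicity: `A` is monotone, and no monotone operator has a strictly larger graph. -/
def IsMaximallyMonotone {E : Type*} [NormedAddCommGroup E] [InnerProductSpace ℝ E]
    (A : E → Set E) : Prop :=
  IsMonotone A ∧ ¬ ∃ B : E → Set E, IsMonotone B ∧ gra A ⊆ gra B ∧ gra B ≠ gra A

/-- The resolvent `(Id + A)⁻¹` as a set-valued operator. -/
def resolventOp {E : Type*} [AddCommGroup E] (A : E → Set E) : E → Set E :=
  invOp (fun x => {x} + A x)

/-- The resolvent `J_A = (Id + A)⁻¹` as a map: `resolventMap A y` is a point `p` with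
`y ∈ p + A p`. If `A` is maximally monotone on a Hilbert space, there is exactly one such point for
every `y`. (The value at a `y` without such a point is irrelevant.) -/
noncomputable def resolventMap {E : Type*} [AddCommGroup E] (A : E → Set E) (y : E) : E :=
  Classical.epsilon (fun p => p ∈ resolventOp A y)

/-- Weak convergence of a sequence. -/
def WeaklyConverges {E : Type*} [NormedAddCommGroup E] [InnerProductSpace ℝ E]
    (u : ℕ → E) (p : E) : Prop :=
  Tendsto (fun n => toWeakSpace ℝ E (u n)) atTop (𝓝 (toWeakSpace ℝ E p))

end Operators

/-! ## Systems of coupled composite monotone inclusions -/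

/-- The data of a system of coupled inclusions: operators `A i` on `H i` and `B k` on `G k`,
offsets `z i` and `r k`, and bounded linear couplings `L k i : H i → G k`. -/
structure CoupledSystem {m K : ℕ} (H : Fin m → Type*) (G : Fin K → Type*)
    [∀ i, NormedAddCommGroup (H i)] [∀ i, InnerProductSpace ℝ (H i)]
    [∀ k, NormedAddCommGroup (G k)] [∀ k, InnerProductSpace ℝ (G k)] where
  A : ∀ i, H i → Set (H i)
  B : ∀ k, G k → Set (G k)
  z : ∀ i, H i
  r : ∀ k, G k
  L : ∀ k i, H i →L[ℝ] G k

namespace CoupledSystem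

variable {m K : ℕ} {H : Fin m → Type*} {G : Fin K → Type*}
  [∀ i, NormedAddCommGroup (H i)] [∀ i, InnerProductSpace ℝ (H i)]
  [∀ i, CompleteSpace (H i)]
  [∀ k, NormedAddCommGroup (G k)] [∀ k, InnerProductSpace ℝ (G k)]
  [∀ k, CompleteSpace (G k)]

/-- The joint coupling operator `x ↦ (∑ i, L k i (x i))_k`. -/
def Lsum (S : CoupledSystem H G) (x : ∀ i, H i) : ∀ k, G k :=
  fun k => ∑ i, S.L k i (x i)

/-- The adjoint of the joint coupling operator, `v ↦ (∑ k, (L k i)⋆ (v k))_i`. -/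
noncomputable def Lsumadj (S : CoupledSystem H G) (v : ∀ k, G k) : ∀ i, H i :=
  fun i => ∑ k, ContinuousLinearMap.adjoint (S.L k i) (v k)

/-- The solutions of the primal problem: the `x` such that
`z ∈ (×ᵢ A i (x i)) + L⋆ (×ₖ B k (∑ j, L k j (x j) - r k))` in the product of the `H i`. The
inclusions indexed by `i` form one system: they share the selections of the sets
`B k (∑ j, L k j (x j) - r k)`. -/
def primalSolutions (S : CoupledSystem H G) : Set (∀ i, H i) :=
  {x | S.z ∈ Set.univ.pi (fun i => S.A i (x i))
      + S.Lsumadj '' Set.univ.pi (fun k => S.B k (S.Lsum x k - S.r k))}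

/-- The solutions of the dual problem: the `v` such that
`-r ∈ -L (×ᵢ (A i)⁻¹ (z i - ∑ l, (L l i)⋆ (v l))) + ×ₖ (B k)⁻¹ (v k)` in the product of the `G k`.
The inclusions indexed by `k` share the selections of the sets
`(A i)⁻¹ (z i - ∑ l, (L l i)⋆ (v l))`. -/
def dualSolutions (S : CoupledSystem H G) : Set (∀ k, G k) :=
  {v | -S.r ∈ -(S.Lsum '' Set.univ.pi (fun i => invOp (S.A i) (S.z i - S.Lsumadj v i)))
      + Set.univ.pi (fun k => invOp (S.B k) (v k))}

/-- The Kuhn-Tucker set. -/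
def kuhnTucker (S : CoupledSystem H G) : Set ((∀ i, H i) × (∀ k, G k)) :=
  {w | (∀ i, S.z i - ∑ k, ContinuousLinearMap.adjoint (S.L k i) (w.2 k) ∈ S.A i (w.1 i)) ∧
       (∀ k, ∑ i, S.L k i (w.1 i) - S.r k ∈ invOp (S.B k) (w.2 k))}

/-! ### One iteration of the algorithm, at the current point `w = (x, v)` -/

/-- `a i = J_{γ A i} (x i + γ (z i - ∑ k, (L k i)⋆ (v k)))`. -/
noncomputable def aPt (S : CoupledSystem H G) (γ : ℝ) (w : (∀ i, H i) × (∀ k, G k)) :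
    ∀ i, H i :=
  fun i => resolventMap (fun y => γ • S.A i y)
    (w.1 i + γ • (S.z i - ∑ k, ContinuousLinearMap.adjoint (S.L k i) (w.2 k)))

/-- `l k = ∑ i, L k i (x i)`. -/
def lPt (S : CoupledSystem H G) (w : (∀ i, H i) × (∀ k, G k)) : ∀ k, G k :=
  fun k => ∑ i, S.L k i (w.1 i)

/-- `b k = r k + J_{μ B k} (l k + μ v k - r k)`. -/
noncomputable def bPt (S : CoupledSystem H G) (μ : ℝ) (w : (∀ i, H i) × (∀ k, G k)) :
    ∀ k, G k :=
  fun k => S.r k + resolventMap (fun y => μ • S.B k y) (S.lPt w k + μ • w.2 k - S.r k)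

/-- `t k = b k - ∑ i, L k i (a i)`. -/
noncomputable def tPt (S : CoupledSystem H G) (γ μ : ℝ) (w : (∀ i, H i) × (∀ k, G k)) :
    ∀ k, G k :=
  fun k => S.bPt μ w k - ∑ i, S.L k i (S.aPt γ w i)

/-- `s i = γ⁻¹ (x i - a i) + μ⁻¹ ∑ k, (L k i)⋆ (l k - b k)`. -/
noncomputable def sPt (S : CoupledSystem H G) (γ μ : ℝ) (w : (∀ i, H i) × (∀ k, G k)) :
    ∀ i, H i :=
  fun i => γ⁻¹ • (w.1 i - S.aPt γ w i)
    + μ⁻¹ • ∑ k, ContinuousLinearMap.adjoint (S.L k i) (S.lPt w k - S.bPt μ w k)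

/-- `τ = ∑ i, ‖s i‖² + ∑ k, ‖t k‖²`; the algorithm stops as soon as `τ = 0`. -/
noncomputable def tau (S : CoupledSystem H G) (γ μ : ℝ) (w : (∀ i, H i) × (∀ k, G k)) : ℝ :=
  ∑ i, ‖S.sPt γ μ w i‖ ^ 2 + ∑ k, ‖S.tPt γ μ w k‖ ^ 2

/-- The point that is returned if `τ = 0`: `(a, v + μ⁻¹ (l - b))`. -/
noncomputable def output (S : CoupledSystem H G) (γ μ : ℝ) (w : (∀ i, H i) × (∀ k, G k)) :
    (∀ i, H i) × (∀ k, G k) :=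
  (S.aPt γ w, fun k => w.2 k + μ⁻¹ • (S.lPt w k - S.bPt μ w k))

/-- The step length
`θ = lam (γ⁻¹ ∑ i, ‖x i - a i‖² + μ⁻¹ ∑ k, ‖l k - b k‖²) / τ`, used only if `τ > 0`. -/
noncomputable def theta (S : CoupledSystem H G) (γ μ lam : ℝ)
    (w : (∀ i, H i) × (∀ k, G k)) : ℝ :=
  lam * (γ⁻¹ * ∑ i, ‖w.1 i - S.aPt γ w i‖ ^ 2
    + μ⁻¹ * ∑ k, ‖S.lPt w k - S.bPt μ w k‖ ^ 2) / S.tau γ μ w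

/-- The next point `(x - θ s, v - θ t)`, used only if `τ > 0`. -/
noncomputable def update (S : CoupledSystem H G) (γ μ lam : ℝ)
    (w : (∀ i, H i) × (∀ k, G k)) : (∀ i, H i) × (∀ k, G k) :=
  (fun i => w.1 i - S.theta γ μ lam w • S.sPt γ μ w i,
   fun k => w.2 k - S.theta γ μ lam w • S.tPt γ μ w k)

/-- The sequence of the points `(x_n, v_n)` produced with the parameters `γ n`, `μ n`, `lam n` from
the starting point `w₀`. The values beyond the first `n` at which `τ = 0`, where the algorithm
stops, have no meaning. -/
noncomputable def iter (S : CoupledSystem H G) (γ μ lam : ℕ → ℝ)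
    (w₀ : (∀ i, H i) × (∀ k, G k)) : ℕ → (∀ i, H i) × (∀ k, G k)
  | 0 => w₀
  | n + 1 => S.update (γ n) (μ n) (lam n) (S.iter γ μ lam w₀ n)

end CoupledSystem

end MonotoneInclusion

/-!
The algorithm is a sequence of relaxed projections onto half-spaces that contain the Kuhn-Tucker
set. On the Hilbert direct sum of all the `H i` and `G k`, the Kuhn-Tucker points are the zeros of
`M (x, v) = (-z + ×ᵢ A i (x i) + L⋆ v, r + ×ₖ (B k)⁻¹ (v k) - L x)`. The linear part
`(x, v) ↦ (L⋆ v, -L x)` is skew, so `M` inherits maximal monotonicity from the `A i` and `B k`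
(`isMaximallyMonotone_ktOp`).

One iteration evaluates the resolvents, which exist by Minty's theorem
(`IsMaximallyMonotone.exists_neg_mem`, obtained from the Fitzpatrick function), and thereby finds a
point `(y, q)` of the graph of `M`, with `q = (s, t)` and `‖q‖² = τ` (`step_mem_ktOp`). If `q = 0`
then `y`, the point returned, is a Kuhn-Tucker point. Otherwise, by monotonicity, the half-space
`{p | ⟪p - y, q⟫ ≤ 0}` contains the zeros of `M`, and the next iterate is the relaxed projection of
the current one `w` onto it. The violation `⟪w - y, q⟫` equals
`γ⁻¹ ‖x - a‖² + μ⁻¹ ‖l - b‖²` (`inner_step_eq_gap`) and, for parameters in `[ε, 1 / ε]`, dominates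
both `‖q‖²` and `‖w - y‖²` (`exists_le_gap`).

Hence the squared distance to each zero decreases by at least a fixed multiple of the violation,
which is therefore summable, and all the residuals with it. Since `q → 0` and `w - y → 0` in norm,
weak cluster points of the iterates are zeros of `M`, and Opial's argument gives weak convergence
(`IsMaximallyMonotone.halfspace_projection_converges`). Cluster points are taken along
ultrafilters, which avoids extracting subsequences.
-/

namespace MonotoneInclusion

/-! ### Maximal monotonicity and Minty's theorem -/

section Minty

variable {E : Type*} [NormedAddCommGroup E] [InnerProductSpace ℝ E]

theorem IsMonotone.inner_nonneg {A : E → Set E} (hA : IsMonotone A) {x y u v : E}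
    (hu : u ∈ A x) (hv : v ∈ A y) : 0 ≤ inner ℝ (x - y) (u - v) :=
  hA (x, u) hu (y, v) hv

theorem IsMaximallyMonotone.mem_of_forall {A : E → Set E} (hA : IsMaximallyMonotone A) {x u : E}
    (h : ∀ a, ∀ b ∈ A a, 0 ≤ inner ℝ (x - a) (u - b)) : u ∈ A x := by
  by_contra hxu
  refine hA.2 ⟨fun y => A y ∪ {v | y = x ∧ v = u}, ?_, fun p hp => Or.inl hp, fun heq => hxu ?_⟩
  · rintro ⟨a, b⟩ hab ⟨c, d⟩ hcd
    change b ∈ A a ∨ a = x ∧ b = u at hab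
    change d ∈ A c ∨ c = x ∧ d = u at hcd
    rcases hab with hab | ⟨rfl, rfl⟩ <;> rcases hcd with hcd | ⟨rfl, rfl⟩
    · exact hA.1.inner_nonneg hab hcd
    · have := h a b hab
      rw [← neg_sub a, ← neg_sub b, inner_neg_neg] at this
      exact this
    · exact h c d hcd
    · simp
  · have : (x, u) ∈ gra (fun y => A y ∪ {v | y = x ∧ v = u}) := Or.inr ⟨rfl, rfl⟩
    rw [heq] at this
    exact this

theorem isMaximallyMonotone_of_forall {A : E → Set E} (hA : IsMonotone A)
    (h : ∀ x u, (∀ a, ∀ b ∈ A a, 0 ≤ inner ℝ (x - a) (u - b)) → u ∈ A x) :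
    IsMaximallyMonotone A := by
  refine ⟨hA, fun ⟨B, hB, hAB, hne⟩ => hne (Set.Subset.antisymm ?_ hAB)⟩
  rintro ⟨x, u⟩ hxu
  exact h x u fun a b hab => hB.inner_nonneg hxu (hAB (show (a, b) ∈ gra A from hab))

theorem IsMaximallyMonotone.exists_mem {A : E → Set E} (hA : IsMaximallyMonotone A) :
    ∃ a, ∃ b, b ∈ A a := by
  by_contra! h
  exact h 0 0 (hA.mem_of_forall fun a b hb => absurd hb (h a b))

/-- A function `t + ‖x‖² / 2` bounded below on a closed convex set of pairs `(x, t)` of a Hilbert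
space and the real line has a minimizer there, which satisfies the first-order optimality
condition. For an epigraph `{(x, t) | f x ≤ t}` this says that `-x ∈ ∂f x` has a solution. -/
theorem exists_first_order_optimal [CompleteSpace E] {C : Set (E × ℝ)} (hne : C.Nonempty)
    (hconv : Convex ℝ C) (hcl : IsClosed C) (hbd : ∀ p ∈ C, 0 ≤ p.2 + ‖p.1‖ ^ 2 / 2) :
    ∃ p ∈ C, ∀ q ∈ C, 0 ≤ q.2 - p.2 + inner ℝ p.1 (q.1 - p.1) := by
  set φ : E × ℝ → ℝ := fun p => p.2 + ‖p.1‖ ^ 2 / 2 with hφ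
  set c := sInf (φ '' C) with hc
  have hbdd : BddBelow (φ '' C) := ⟨0, by rintro _ ⟨p, hp, rfl⟩; exact hbd p hp⟩
  have hle : ∀ p ∈ C, c ≤ φ p := fun p hp => csInf_le hbdd ⟨p, hp, rfl⟩
  have hex : ∀ n : ℕ, ∃ p ∈ C, φ p < c + 1 / ((n : ℝ) + 1) := fun n => by
    obtain ⟨_, ⟨p, hp, rfl⟩, h⟩ := exists_lt_of_csInf_lt (hne.image φ)
      (show sInf (φ '' C) < c + 1 / ((n : ℝ) + 1) from lt_add_of_pos_right _ (by positivity))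
    exact ⟨p, hp, h⟩
  choose u huC hu using hex
  -- the parallelogram law, applied to the midpoint
  have hmid : ∀ p ∈ C, ∀ q ∈ C, ‖p.1 - q.1‖ ^ 2 ≤ 4 * (φ p - c) + 4 * (φ q - c) := by
    intro p hp q hq
    have h1 := hle _ (hconv hp hq (show (0 : ℝ) ≤ 1 / 2 by norm_num)
      (show (0 : ℝ) ≤ 1 / 2 by norm_num) (by norm_num))
    simp only [hφ, Prod.snd_add, Prod.fst_add, Prod.smul_fst, Prod.smul_snd, smul_eq_mul,
      ← smul_add, norm_smul, mul_pow] at h1 ⊢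
    have h2 := parallelogram_law_with_norm ℝ p.1 q.1
    norm_num at h1
    nlinarith
  have hcau : CauchySeq (fun n => (u n).1) := by
    refine cauchySeq_of_le_tendsto_0 (fun N : ℕ => √(8 * (1 / ((N : ℝ) + 1)))) ?_ ?_
    · intro n m N hn hm
      rw [dist_eq_norm]
      apply Real.le_sqrt_of_sq_le
      have h1 := hmid _ (huC n) _ (huC m)
      have h2 := (hu n).le
      have h3 := (hu m).le
      have h4 := Nat.one_div_le_one_div (α := ℝ) hn
      have h5 := Nat.one_div_le_one_div (α := ℝ) hm
      linarith
    · have := (Real.continuous_sqrt.tendsto _).comp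
        ((tendsto_one_div_add_atTop_nhds_zero_nat (𝕜 := ℝ)).const_mul 8)
      simpa only [mul_zero, Real.sqrt_zero, Function.comp_def] using this
  obtain ⟨x, hx⟩ := cauchySeq_tendsto_of_complete hcau
  have hφu : Tendsto (fun n => φ (u n)) atTop (𝓝 c) := by
    refine tendsto_of_tendsto_of_tendsto_of_le_of_le tendsto_const_nhds
      (by simpa using (tendsto_one_div_add_atTop_nhds_zero_nat (𝕜 := ℝ)).const_add c)
      (fun n => hle _ (huC n)) (fun n => (hu n).le)
  have ht : Tendsto (fun n => (u n).2) atTop (𝓝 (c - ‖x‖ ^ 2 / 2)) := by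
    have := hφu.sub ((hx.norm.pow 2).div_const 2)
    simpa [hφ] using this
  have hmem : (x, c - ‖x‖ ^ 2 / 2) ∈ C :=
    hcl.mem_of_tendsto (hx.prodMk_nhds ht) (Eventually.of_forall huC)
  refine ⟨_, hmem, fun q hq => ?_⟩
  by_contra! hneg
  set D := q.2 - (c - ‖x‖ ^ 2 / 2) + inner ℝ x (q.1 - x) with hD
  -- a short step from the minimizer towards `q` would decrease `φ`
  set s := min 1 (-D / (‖q.1 - x‖ ^ 2 + 1)) with hs
  have hs0 : 0 < s := lt_min one_pos (div_pos (by linarith) (by positivity))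
  have hs1 : s ≤ 1 := min_le_left _ _
  have hs2 : s * (‖q.1 - x‖ ^ 2 + 1) ≤ -D :=
    (le_div_iff₀ (by positivity)).1 (min_le_right _ _)
  have h1 := hle _ (hconv.add_smul_sub_mem hmem hq ⟨hs0.le, hs1⟩)
  simp only [hφ, Prod.snd_add, Prod.fst_add, Prod.smul_fst, Prod.smul_snd, smul_eq_mul,
    Prod.fst_sub, Prod.snd_sub, norm_add_sq_real, norm_smul, inner_smul_right, mul_pow,
    Real.norm_eq_abs, sq_abs] at h1
  have h2 : 0 ≤ s * (D + s * ‖q.1 - x‖ ^ 2 / 2) := by rw [hD]; nlinarith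
  have h3 := nonneg_of_mul_nonneg_right h2 hs0
  nlinarith [sq_nonneg ‖q.1 - x‖]

/-- **Minty's theorem**, at the origin: if `A` is maximally monotone, then `0 ∈ x + A x` for some
`x`. With the Fitzpatrick function `F (x, u) = sup {⟪x, b⟫ + ⟪a, u⟫ - ⟪a, b⟫ | b ∈ A a}`, which
majorizes `⟪x, u⟫` by maximality, a minimizer `(x, u)` of `F + ‖·‖² / 2` satisfies
`⟪a + u, b + x⟫ ≥ ‖x + u‖²` on the graph; so `-x ∈ A (-u)`, and then `u = -x`. -/
theorem IsMaximallyMonotone.exists_neg_mem [CompleteSpace E] {A : E → Set E}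
    (hA : IsMaximallyMonotone A) : ∃ x, -x ∈ A x := by
  let C : Set (WithLp 2 (E × E) × ℝ) :=
    {p | ∀ a, ∀ b ∈ A a, inner ℝ p.1.fst b + inner ℝ a p.1.snd - inner ℝ a b ≤ p.2}
  have hgr : ∀ a, ∀ b ∈ A a, (WithLp.toLp 2 (a, b), inner ℝ a b) ∈ C := by
    intro a b hab a' b' hab'
    have h := hA.1.inner_nonneg hab hab'
    simp only [inner_sub_left, inner_sub_right] at h
    change inner ℝ a b' + inner ℝ a' b - inner ℝ a' b' ≤ inner ℝ a b
    linarith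
  have hmaj : ∀ p ∈ C, inner ℝ p.1.fst p.1.snd ≤ p.2 := by
    intro p hp
    by_contra! hlt
    have hmem : p.1.snd ∈ A p.1.fst := hA.mem_of_forall fun a b hab => by
      have := hp a b hab
      simp only [inner_sub_left, inner_sub_right]
      linarith
    have := hp _ _ hmem
    linarith
  have hcont : ∀ a b : E, Continuous fun p : WithLp 2 (E × E) × ℝ =>
      inner ℝ p.1.fst b + inner ℝ a p.1.snd - inner ℝ a b := fun a b => by
    have h1 : Continuous fun p : WithLp 2 (E × E) × ℝ => p.1.fst :=
      (WithLp.fstL 2 ℝ E E).continuous.comp continuous_fst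
    have h2 : Continuous fun p : WithLp 2 (E × E) × ℝ => p.1.snd :=
      (WithLp.sndL 2 ℝ E E).continuous.comp continuous_fst
    fun_prop
  have hne : C.Nonempty := by
    obtain ⟨a, b, hab⟩ := hA.exists_mem
    exact ⟨_, hgr a b hab⟩
  have hconv : Convex ℝ C := by
    intro p hp q hq s t hs ht hst a b hab
    have h1 := mul_le_mul_of_nonneg_left (hp a b hab) hs
    have h2 := mul_le_mul_of_nonneg_left (hq a b hab) ht
    change inner ℝ (s • p.1.fst + t • q.1.fst) b + inner ℝ a (s • p.1.snd + t • q.1.snd)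
      - inner ℝ a b ≤ s * p.2 + t * q.2
    simp only [inner_add_left, inner_add_right, real_inner_smul_left, real_inner_smul_right]
    have : inner ℝ a b = s * inner ℝ a b + t * inner ℝ a b := by rw [← add_mul, hst, one_mul]
    linarith
  have hcl : IsClosed C := by
    have : C = ⋂ a, ⋂ b, ⋂ _ : b ∈ A a, {p : WithLp 2 (E × E) × ℝ |
        inner ℝ p.1.fst b + inner ℝ a p.1.snd - inner ℝ a b ≤ p.2} := by
      ext p; simp [C]
    rw [this]
    exact isClosed_iInter fun a => isClosed_iInter fun b => isClosed_iInter fun _ =>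
      isClosed_le (hcont a b) continuous_snd
  have hbd : ∀ p ∈ C, 0 ≤ p.2 + ‖p.1‖ ^ 2 / 2 := by
    intro p hp
    have h1 := hmaj p hp
    have h2 := norm_add_sq_real p.1.fst p.1.snd
    rw [WithLp.prod_norm_sq_eq_of_L2]
    nlinarith [sq_nonneg ‖p.1.fst + p.1.snd‖]
  obtain ⟨p, hp, hopt⟩ := exists_first_order_optimal (C := C) hne hconv hcl hbd
  set x := p.1.fst
  set u := p.1.snd
  have key : ∀ a, ∀ b ∈ A a, ‖x + u‖ ^ 2 ≤ inner ℝ (a + u) (b + x) := by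
    intro a b hab
    have h1 := hopt _ (hgr a b hab)
    have h2 := hmaj p hp
    rw [WithLp.prod_inner_apply] at h1
    change 0 ≤ inner ℝ a b - p.2 + (inner ℝ x (a - x) + inner ℝ u (b - u)) at h1
    change inner ℝ x u ≤ p.2 at h2
    rw [norm_add_sq_real]
    simp only [inner_sub_right, inner_add_left, inner_add_right, real_inner_self_eq_norm_sq]
      at h1 ⊢
    rw [real_inner_comm x u, real_inner_comm x a]
    linarith
  have hmem : -x ∈ A (-u) := hA.mem_of_forall fun a b hab => by
    have h := (sq_nonneg ‖x + u‖).trans (key a b hab)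
    rw [← neg_add', ← neg_add', inner_neg_neg, add_comm u, add_comm x]
    exact h
  have h0 := key _ _ hmem
  have hxu : x + u = 0 := by
    rw [← norm_eq_zero, ← sq_eq_zero_iff]
    exact le_antisymm (by simpa using h0) (sq_nonneg _)
  rw [← eq_neg_of_add_eq_zero_left hxu] at hmem
  exact ⟨x, hmem⟩

/-- The defining property of the resolvent of `γ A`; the existence of the point it selects is
Minty's theorem, applied to `p ↦ γ A p - y`. -/
theorem IsMaximallyMonotone.resolventMap_smul_mem [CompleteSpace E] {A : E → Set E}
    (hA : IsMaximallyMonotone A) {γ : ℝ} (hγ : 0 < γ) (y : E) :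
    γ⁻¹ • (y - resolventMap (fun x => γ • A x) y) ∈ A (resolventMap (fun x => γ • A x) y) := by
  have hiff : ∀ p, p ∈ resolventOp (fun x => γ • A x) y ↔ γ⁻¹ • (y - p) ∈ A p := by
    intro p
    change y ∈ {p} + γ • A p ↔ _
    rw [Set.singleton_add, Set.image_add_left, Set.mem_preimage,
      Set.mem_smul_set_iff_inv_smul_mem₀ hγ.ne', neg_add_eq_sub]
  have hmax : IsMaximallyMonotone fun p => {b | γ⁻¹ • (b + y) ∈ A p} := by
    have hγ' := inv_pos.2 hγ
    refine isMaximallyMonotone_of_forall ?_ fun x u h => hA.mem_of_forall fun a b hab => ?_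
    · rintro ⟨a, b⟩ hab ⟨c, d⟩ hcd
      have h := hA.1.inner_nonneg hab hcd
      rw [← smul_sub, real_inner_smul_right, add_sub_add_right_eq_sub] at h
      exact nonneg_of_mul_nonneg_right h hγ'
    · have h := mul_nonneg hγ'.le (h a (γ • b - y) (by
        rwa [Set.mem_ofPred_eq, sub_add_cancel, inv_smul_smul₀ hγ.ne']))
      rw [← real_inner_smul_right] at h
      have heq : γ⁻¹ • (u - (γ • b - y)) = γ⁻¹ • (u + y) - b := by
        rw [sub_sub_eq_add_sub, add_comm u, smul_sub, inv_smul_smul₀ hγ.ne', add_comm y]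
      rwa [heq] at h
  obtain ⟨p, hp⟩ := hmax.exists_neg_mem
  refine (hiff _).1 (Classical.epsilon_spec (p := fun p => p ∈ resolventOp _ y) ⟨p, ?_⟩)
  rw [hiff, ← neg_add_eq_sub]
  exact hp

end Minty

/-! ### Weak convergence in Hilbert spaces -/

section Weak

variable {E : Type*} [NormedAddCommGroup E] [InnerProductSpace ℝ E]

theorem weaklyConverges_iff_forall_dual {u : ℕ → E} {p : E} :
    WeaklyConverges u p ↔ ∀ f : E →L[ℝ] ℝ, Tendsto (fun n => f (u n)) atTop (𝓝 (f p)) :=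
  WeakBilin.tendsto_iff_forall_eval_tendsto (topDualPairing ℝ E).flip
    fun _ _ hxy => (SeparatingDual.eq_iff_forall_dual_eq (R := ℝ)).2 fun f =>
      LinearMap.congr_fun hxy f

theorem weaklyConverges_of_forall_inner [CompleteSpace E] {u : ℕ → E} {p : E}
    (h : ∀ y, Tendsto (fun n => inner ℝ (u n) y) atTop (𝓝 (inner ℝ p y))) :
    WeaklyConverges u p := by
  refine weaklyConverges_iff_forall_dual.2 fun f => ?_
  have := h ((InnerProductSpace.toDual ℝ E).symm f)
  simpa only [real_inner_comm ((InnerProductSpace.toDual ℝ E).symm f),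
    InnerProductSpace.toDual_symm_apply] using this

theorem WeaklyConverges.map {F : Type*} [NormedAddCommGroup F] [InnerProductSpace ℝ F]
    {u : ℕ → E} {p : E} (h : WeaklyConverges u p) (T : E →L[ℝ] F) :
    WeaklyConverges (fun n => T (u n)) (T p) :=
  weaklyConverges_iff_forall_dual.2 fun f => weaklyConverges_iff_forall_dual.1 h (f.comp T)

/-- A bounded sequence of a Hilbert space converges weakly along every ultrafilter: the
Banach-Alaoglu theorem, transported by the Riesz isomorphism. -/
theorem exists_forall_tendsto_inner [CompleteSpace E] {ι : Type*} (U : Ultrafilter ι) {u : ι → E}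
    {R : ℝ} (hu : ∀ n, ‖u n‖ ≤ R) :
    ∃ p, ∀ y, Tendsto (fun n => inner ℝ (u n) y) U (𝓝 (inner ℝ p y)) := by
  let g : ι → WeakDual ℝ E := fun n =>
    StrongDual.toWeakDual (InnerProductSpace.toDual ℝ E (u n))
  obtain ⟨f, -, hf⟩ := (WeakDual.isCompact_closedBall (𝕜 := ℝ) (E := E) 0 R).ultrafilter_le_nhds
    (U.map g) (by
      refine le_principal_iff.2 (Eventually.of_forall (f := (U : Filter ι)) fun n => ?_)
      change InnerProductSpace.toDual ℝ E (u n) ∈ Metric.closedBall _ _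
      simpa using hu n)
  refine ⟨(InnerProductSpace.toDual ℝ E).symm (WeakDual.toStrongDual f), fun y => ?_⟩
  rw [InnerProductSpace.toDual_symm_apply]
  exact ((WeakDual.eval_continuous y).tendsto f).comp hf

/-- Opial's lemma, with cluster points along ultrafilters: a bounded sequence converges weakly to a
point of `Z` if its weak cluster points lie in `Z` and its distances to the points of `Z`
converge. -/
theorem exists_weaklyConverges_of_cluster [CompleteSpace E] {Z : Set E} {u : ℕ → E} {R : ℝ}
    (hu : ∀ n, ‖u n‖ ≤ R)
    (hdist : ∀ z ∈ Z, ∃ l, Tendsto (fun n => ‖u n - z‖ ^ 2) atTop (𝓝 l))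
    (hclu : ∀ (U : Ultrafilter ℕ) (p : E), (U : Filter ℕ) ≤ atTop →
      (∀ y, Tendsto (fun n => inner ℝ (u n) y) U (𝓝 (inner ℝ p y))) → p ∈ Z) :
    ∃ p ∈ Z, WeaklyConverges u p := by
  obtain ⟨p, hp⟩ := exists_forall_tendsto_inner (Ultrafilter.of atTop) hu
  have hpZ := hclu _ p (Ultrafilter.of_le _) hp
  refine ⟨p, hpZ, weaklyConverges_of_forall_inner fun y => ?_⟩
  refine (tendsto_iff_ultrafilter _ _ _).2 fun U hU => ?_
  obtain ⟨q, hq⟩ := exists_forall_tendsto_inner U hu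
  have hqZ := hclu U q hU hq
  suffices hpq : p = q by rw [hpq]; exact hq y
  obtain ⟨l₁, h₁⟩ := hdist p hpZ
  obtain ⟨l₂, h₂⟩ := hdist q hqZ
  -- `⟪u n, p - q⟫` converges, so its limits along the two ultrafilters agree
  have h : Tendsto (fun n => inner ℝ (u n) (p - q)) atTop
      (𝓝 ((l₂ - l₁ + ‖p‖ ^ 2 - ‖q‖ ^ 2) / 2)) := by
    refine ((((h₂.sub h₁).add_const (‖p‖ ^ 2)).sub_const (‖q‖ ^ 2)).div_const 2).congr fun n => ?_
    rw [norm_sub_sq_real, norm_sub_sq_real, inner_sub_right]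
    ring
  have e₁ := tendsto_nhds_unique (hp (p - q)) (h.mono_left (Ultrafilter.of_le _))
  have e₂ := tendsto_nhds_unique (hq (p - q)) (h.mono_left hU)
  rw [← sub_eq_zero, ← inner_self_eq_zero (𝕜 := ℝ), inner_sub_left, e₁, e₂, sub_self]

/-- Weak-strong closedness of the graph of a maximally monotone operator, for values that tend
to `0`. Boundedness of the arguments makes the inner products with the values tend to `0`. -/
theorem IsMaximallyMonotone.zero_mem_of_tendsto {M : E → Set E} (hM : IsMaximallyMonotone M)
    {ι : Type*} {l : Filter ι} [l.NeBot] {y q : ι → E} {R : ℝ} (hy : ∀ n, ‖y n‖ ≤ R) {p : E}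
    (hyp : ∀ e, Tendsto (fun n => inner ℝ (y n) e) l (𝓝 (inner ℝ p e)))
    (hq : Tendsto q l (𝓝 0)) (hmem : ∀ n, q n ∈ M (y n)) : (0 : E) ∈ M p := by
  refine hM.mem_of_forall fun a b hab => ?_
  have h₁ : Tendsto (fun n => inner ℝ (y n - a) (q n)) l (𝓝 0) := by
    refine squeeze_zero_norm (a := fun n => (R + ‖a‖) * ‖q n‖) (fun n => ?_) ?_
    · refine (norm_inner_le_norm _ _).trans (mul_le_mul_of_nonneg_right ?_ (norm_nonneg _))
      exact (norm_sub_le _ _).trans (add_le_add_left (hy n) _)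
    · simpa using hq.norm.const_mul (R + ‖a‖)
  have h₂ := (h₁.sub (hyp b)).add_const (inner ℝ a b)
  have h₃ := ge_of_tendsto' (b := 0) h₂ fun n => by
    have h := hM.1.inner_nonneg (hmem n) hab
    rw [inner_sub_right, inner_sub_left _ _ b] at h
    linarith
  rw [zero_sub, inner_neg_right, inner_sub_left]
  linarith

end Weak

/-! ### Projections onto separating half-spaces -/

section Projection

variable {E : Type*} [NormedAddCommGroup E] [InnerProductSpace ℝ E] [CompleteSpace E]

/-- Convergence of relaxed projections onto half-spaces cut out by points `(y n, q n)` of the graph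
of a maximally monotone operator `M`. By monotonicity the half-space
`{z | ⟪z - y n, q n⟫ ≤ 0}` contains the zeros of `M`; `δ n = ⟪w n - y n, q n⟫` measures by how much
`w n` violates it, and `w (n + 1)` is the projection of `w n` onto it, relaxed by `lam n`. The two
bounds by `δ n` say that the violation controls the residuals `q n` and `w n - y n`. -/
theorem IsMaximallyMonotone.halfspace_projection_converges {M : E → Set E}
    (hM : IsMaximallyMonotone M) (hZ : ∃ z, (0 : E) ∈ M z) {ε C : ℝ} (hε : 0 < ε) (hC : 0 < C)
    {lam : ℕ → ℝ} (hlam : ∀ n, lam n ∈ Set.Icc ε (2 - ε)) {w y q : ℕ → E} {δ : ℕ → ℝ}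
    (hmem : ∀ n, q n ∈ M (y n)) (hq0 : ∀ n, q n ≠ 0)
    (hδ : ∀ n, inner ℝ (w n - y n) (q n) = δ n)
    (hqδ : ∀ n, ‖q n‖ ^ 2 ≤ C * δ n) (hwδ : ∀ n, ‖w n - y n‖ ^ 2 ≤ C * δ n)
    (hw : ∀ n, w (n + 1) = w n - (lam n * δ n / ‖q n‖ ^ 2) • q n) :
    Summable δ ∧ (Summable fun n => ‖w (n + 1) - w n‖ ^ 2) ∧
      ∃ p, (0 : E) ∈ M p ∧ WeaklyConverges w p := by
  have hqpos : ∀ n, 0 < ‖q n‖ ^ 2 := fun n => by have := hq0 n; positivity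
  have hδ0 : ∀ n, 0 < δ n := fun n =>
    pos_of_mul_pos_right ((hqpos n).trans_le (hqδ n)) hC.le
  have hstep : ∀ n, ‖w (n + 1) - w n‖ ^ 2 = lam n ^ 2 * (δ n ^ 2 / ‖q n‖ ^ 2) := by
    intro n
    have := (hqpos n).ne'
    rw [hw, sub_sub_cancel_left, norm_neg, norm_smul, mul_pow, Real.norm_eq_abs, sq_abs]
    field_simp
  have hfejer : ∀ z, (0 : E) ∈ M z → ∀ n,
      ε ^ 2 * (δ n ^ 2 / ‖q n‖ ^ 2) ≤ ‖w n - z‖ ^ 2 - ‖w (n + 1) - z‖ ^ 2 := by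
    intro z hz n
    have h1 := hM.1.inner_nonneg (hmem n) hz
    have h2 : δ n ≤ inner ℝ (w n - z) (q n) := by
      rw [sub_zero] at h1
      rw [← hδ, ← sub_add_sub_cancel (w n) (y n) z, inner_add_left]
      linarith
    obtain ⟨hl1, hl2⟩ := hlam n
    have h3 : 0 ≤ lam n * δ n / ‖q n‖ ^ 2 :=
      div_nonneg (mul_nonneg (hε.le.trans hl1) (hδ0 n).le) (hqpos n).le
    have h4 := mul_le_mul_of_nonneg_left h2 h3
    have h5 : ‖w (n + 1) - z‖ ^ 2 = ‖w n - z‖ ^ 2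
        - 2 * (lam n * δ n / ‖q n‖ ^ 2 * inner ℝ (w n - z) (q n))
        + lam n ^ 2 * (δ n ^ 2 / ‖q n‖ ^ 2) := by
      rw [← hstep, hw, sub_right_comm, norm_sub_sq_real, inner_smul_right, sub_sub_cancel_left,
        norm_neg]
    have h6 : lam n * δ n / ‖q n‖ ^ 2 * δ n = lam n * (δ n ^ 2 / ‖q n‖ ^ 2) := by ring
    -- `s ↦ s (2 - s)` is at least `ε (2 - ε)` on `[ε, 2 - ε]`, and `ε ≤ 1`
    have h7 : ε ^ 2 ≤ lam n * (2 - lam n) := by nlinarith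
    have h8 := mul_le_mul_of_nonneg_right h7
      (show 0 ≤ δ n ^ 2 / ‖q n‖ ^ 2 by positivity)
    rw [h5]
    nlinarith
  obtain ⟨z₀, hz₀⟩ := hZ
  have hsum : Summable fun n => δ n ^ 2 / ‖q n‖ ^ 2 := by
    refine summable_of_sum_range_le (c := ‖w 0 - z₀‖ ^ 2 / ε ^ 2) (fun n => by positivity)
      fun n => ?_
    rw [le_div_iff₀ (by positivity), mul_comm, Finset.mul_sum]
    refine (Finset.sum_le_sum fun i _ => hfejer z₀ hz₀ i).trans ?_
    rw [Finset.sum_range_sub' (fun n => ‖w n - z₀‖ ^ 2)]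
    linarith [sq_nonneg ‖w n - z₀‖]
  have hδsum : Summable δ := by
    refine Summable.of_nonneg_of_le (fun n => (hδ0 n).le) (fun n => ?_) (hsum.mul_left C)
    rw [mul_div_assoc', le_div_iff₀ (hqpos n)]
    nlinarith [mul_le_mul_of_nonneg_left (hqδ n) (hδ0 n).le]
  have hanti : ∀ z, (0 : E) ∈ M z → Antitone fun n => ‖w n - z‖ ^ 2 := fun z hz =>
    antitone_nat_of_succ_le fun n => by
      have := hfejer z hz n
      have : 0 ≤ ε ^ 2 * (δ n ^ 2 / ‖q n‖ ^ 2) := by positivity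
      linarith
  have hbdd : ∀ n, ‖w n‖ ≤ ‖w 0 - z₀‖ + ‖z₀‖ := fun n => by
    have h1 := abs_le_of_sq_le_sq' (hanti z₀ hz₀ (Nat.zero_le n)) (norm_nonneg _) |>.2
    have h2 := norm_add_le (w n - z₀) z₀
    rw [sub_add_cancel] at h2
    linarith
  have hqlim : Tendsto q atTop (𝓝 0) := by
    rw [tendsto_zero_iff_norm_tendsto_zero]
    have h := squeeze_zero (fun n => sq_nonneg ‖q n‖) hqδ
      (by simpa using hδsum.tendsto_atTop_zero.const_mul C)
    simpa [Real.sqrt_sq] using h.sqrt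
  have hwy : Tendsto (fun n => w n - y n) atTop (𝓝 0) := by
    rw [tendsto_zero_iff_norm_tendsto_zero]
    have h := squeeze_zero (fun n => sq_nonneg ‖w n - y n‖) hwδ
      (by simpa using hδsum.tendsto_atTop_zero.const_mul C)
    simpa [Real.sqrt_sq] using h.sqrt
  refine ⟨hδsum, ?_, ?_⟩
  · refine Summable.of_nonneg_of_le (fun n => by positivity) (fun n => ?_) (hsum.mul_left 4)
    obtain ⟨hl1, hl2⟩ := hlam n
    rw [hstep]
    exact mul_le_mul_of_nonneg_right (by nlinarith) (by positivity)
  · refine exists_weaklyConverges_of_cluster (Z := {z | (0 : E) ∈ M z}) hbdd (fun z hz => ?_)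
      fun U p hU hp => ?_
    · exact ⟨_, tendsto_atTop_ciInf (hanti z hz) ⟨0, by rintro _ ⟨n, rfl⟩; positivity⟩⟩
    · obtain ⟨R, hR⟩ := hwy.norm.bddAbove_range
      refine hM.zero_mem_of_tendsto (R := ‖w 0 - z₀‖ + ‖z₀‖ + R) (y := y) (q := q) (l := U)
        (fun n => ?_) (fun e => ?_) (hqlim.mono_left hU) hmem
      · have h1 := hbdd n
        have h2 : ‖w n - y n‖ ≤ R := hR ⟨n, rfl⟩
        have h3 := norm_sub_le (w n) (w n - y n)
        rw [sub_sub_cancel] at h3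
        linarith
      · have h := (hwy.mono_left hU).inner (𝕜 := ℝ) (tendsto_const_nhds (x := e))
        simpa [inner_sub_left] using (hp e).sub h

end Projection

/-! ### The Kuhn-Tucker operator -/

/-- By the Cauchy-Schwarz inequality, a finite family of bounded operators is bounded between the
Euclidean product norms. -/
theorem exists_sum_norm_sq_le {ι κ : Type*} [Fintype ι] [Fintype κ] {X : ι → Type*} {Y : κ → Type*}
    [∀ i, NormedAddCommGroup (X i)] [∀ i, NormedSpace ℝ (X i)]
    [∀ k, NormedAddCommGroup (Y k)] [∀ k, NormedSpace ℝ (Y k)] (T : ∀ k i, X i →L[ℝ] Y k) :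
    ∃ C, 0 ≤ C ∧ ∀ x : ∀ i, X i, ∑ k, ‖∑ i, T k i (x i)‖ ^ 2 ≤ C * ∑ i, ‖x i‖ ^ 2 := by
  refine ⟨∑ k, ∑ i, ‖T k i‖ ^ 2, by positivity, fun x => ?_⟩
  rw [Finset.sum_mul]
  refine Finset.sum_le_sum fun k _ => ?_
  refine le_trans ?_ (Finset.sum_mul_sq_le_sq_mul_sq Finset.univ _ _)
  refine pow_le_pow_left₀ (norm_nonneg _) ?_ 2
  exact norm_sum_le_of_le _ fun i _ => (T k i).le_opNorm (x i)

/-- If a sum over a finite index set is nonnegative for all selections, and every summand can be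
made nonpositive, then no summand takes a negative value. -/
theorem nonneg_of_forall_selection {ι : Type*} [Fintype ι] {X : ι → Type*} {f : ∀ i, X i → ℝ}
    (hf : ∀ i, ∃ x, f i x ≤ 0) (h : ∀ x : ∀ i, X i, 0 ≤ ∑ i, f i (x i)) (i : ι) (x : X i) :
    0 ≤ f i x := by
  classical
  choose y hy using hf
  by_contra! hx
  refine (h (Function.update y i x)).not_gt
    (Finset.sum_neg' (fun j _ => ?_) ⟨i, Finset.mem_univ i, ?_⟩)
  · by_cases hj : j = i
    · subst hj; simpa using hx.le
    · simpa [hj] using hy j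
  · simpa using hx

/-- If `(x, u)` is not in the graph of `A`, maximality gives a point of the graph for which the inner
product is negative; if it is, the point `(x, u)` itself gives `0`. -/
theorem IsMaximallyMonotone.exists_inner_nonpos {E : Type*} [NormedAddCommGroup E]
    [InnerProductSpace ℝ E] {A : E → Set E} (hA : IsMaximallyMonotone A) (x u : E) :
    ∃ p : gra A, inner ℝ (x - p.1.1) (u - p.1.2) ≤ 0 := by
  by_cases h : u ∈ A x
  · exact ⟨⟨(x, u), h⟩, by simp⟩
  · by_contra! hp
    exact h (hA.mem_of_forall fun a b hab => (hp ⟨(a, b), hab⟩).le)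

theorem norm_add_sq_le {X : Type*} [SeminormedAddCommGroup X] (x y : X) :
    ‖x + y‖ ^ 2 ≤ 2 * (‖x‖ ^ 2 + ‖y‖ ^ 2) :=
  (pow_le_pow_left₀ (norm_nonneg _) (norm_add_le x y) 2).trans add_sq_le

namespace CoupledSystem

variable {m K : ℕ} {H : Fin m → Type*} {G : Fin K → Type*}
  [∀ i, NormedAddCommGroup (H i)] [∀ k, NormedAddCommGroup (G k)]

variable (H G) in
/-- The Hilbert direct sum of all the spaces `H i` and `G k`. -/
abbrev KTSpace : Type _ := WithLp 2 (PiLp 2 H × PiLp 2 G)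

/-- A pair of families, as a point of the Hilbert direct sum. -/
def toKT (w : (∀ i, H i) × (∀ k, G k)) : KTSpace H G :=
  WithLp.toLp 2 (WithLp.toLp 2 w.1, WithLp.toLp 2 w.2)

theorem norm_sq_kt (p : KTSpace H G) :
    ‖p‖ ^ 2 = ∑ i, ‖p.fst i‖ ^ 2 + ∑ k, ‖p.snd k‖ ^ 2 := by
  rw [WithLp.prod_norm_sq_eq_of_L2, PiLp.norm_sq_eq_of_L2, PiLp.norm_sq_eq_of_L2]

variable [∀ i, InnerProductSpace ℝ (H i)] [∀ k, InnerProductSpace ℝ (G k)]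

theorem inner_kt (p q : KTSpace H G) :
    inner ℝ p q = ∑ i, inner ℝ (p.fst i) (q.fst i) + ∑ k, inner ℝ (p.snd k) (q.snd k) := by
  rw [WithLp.prod_inner_apply]
  rfl

theorem Lsum_sub (S : CoupledSystem H G) (x y : ∀ i, H i) (k : Fin K) :
    S.Lsum (x - y) k = S.Lsum x k - S.Lsum y k := by
  simp [Lsum, Finset.sum_sub_distrib]

variable [∀ i, CompleteSpace (H i)] [∀ k, CompleteSpace (G k)]

/-- The Kuhn-Tucker operator
`(x, v) ↦ (-z + ×ᵢ A i (x i) + L⋆ v, r + ×ₖ (B k)⁻¹ (v k) - L x)`. Membership of `q` is spelled out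
by coordinates, with the summand in `A i (x i)` and the point at which `B k` takes the value `v k`
expressed through `q`. -/
def ktOp (S : CoupledSystem H G) (p : KTSpace H G) : Set (KTSpace H G) :=
  {q | (∀ i, q.fst i + S.z i - S.Lsumadj p.snd i ∈ S.A i (p.fst i)) ∧
    ∀ k, p.snd k ∈ S.B k (q.snd k - S.r k + S.Lsum p.fst k)}

theorem sum_inner_Lsum (S : CoupledSystem H G) (x : ∀ i, H i) (v : ∀ k, G k) :
    ∑ k, inner ℝ (v k) (S.Lsum x k) = ∑ i, inner ℝ (x i) (S.Lsumadj v i) := by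
  simp only [Lsum, Lsumadj, inner_sum, ContinuousLinearMap.adjoint_inner_right]
  rw [Finset.sum_comm]
  exact Finset.sum_congr rfl fun _ _ => Finset.sum_congr rfl fun _ _ => real_inner_comm _ _

theorem Lsumadj_sub (S : CoupledSystem H G) (x y : ∀ k, G k) (i : Fin m) :
    S.Lsumadj (x - y) i = S.Lsumadj x i - S.Lsumadj y i := by
  simp [Lsumadj, Finset.sum_sub_distrib]

/-- The skew part `(x, v) ↦ (L⋆ v, -L x)` of the Kuhn-Tucker operator does not contribute to the
inner products that define monotonicity. -/
theorem inner_sub_kt (S : CoupledSystem H G) (p p' q q' : KTSpace H G) :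
    inner ℝ (p - p') (q - q') =
      ∑ i, inner ℝ (p.fst i - p'.fst i)
        ((q.fst i + S.z i - S.Lsumadj p.snd i) - (q'.fst i + S.z i - S.Lsumadj p'.snd i)) +
      ∑ k, inner ℝ ((q.snd k - S.r k + S.Lsum p.fst k) - (q'.snd k - S.r k + S.Lsum p'.fst k))
        (p.snd k - p'.snd k) := by
  have h := S.sum_inner_Lsum (fun i => p.fst i - p'.fst i) (fun k => p.snd k - p'.snd k)
  have h₁ : ∀ k, S.Lsum (fun i => p.fst i - p'.fst i) k = S.Lsum p.fst k - S.Lsum p'.fst k :=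
    fun k => S.Lsum_sub _ _ k
  have h₂ : ∀ i, S.Lsumadj (fun k => p.snd k - p'.snd k) i
      = S.Lsumadj p.snd i - S.Lsumadj p'.snd i := fun i => S.Lsumadj_sub _ _ i
  simp only [h₁, h₂] at h
  have e₁ : ∀ i, inner ℝ (p.fst i - p'.fst i)
        ((q.fst i + S.z i - S.Lsumadj p.snd i) - (q'.fst i + S.z i - S.Lsumadj p'.snd i))
      = inner ℝ (p.fst i - p'.fst i) (q.fst i - q'.fst i)
        - inner ℝ (p.fst i - p'.fst i) (S.Lsumadj p.snd i - S.Lsumadj p'.snd i) := fun i => by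
    rw [← inner_sub_right]
    congr 1
    abel
  have e₂ : ∀ k, inner ℝ
        ((q.snd k - S.r k + S.Lsum p.fst k) - (q'.snd k - S.r k + S.Lsum p'.fst k))
        (p.snd k - p'.snd k)
      = inner ℝ (p.snd k - p'.snd k) (q.snd k - q'.snd k)
        + inner ℝ (p.snd k - p'.snd k) (S.Lsum p.fst k - S.Lsum p'.fst k) := fun k => by
    rw [← inner_add_right, real_inner_comm]
    congr 1
    abel
  simp only [e₁, e₂, Finset.sum_sub_distrib, Finset.sum_add_distrib, h, inner_kt]
  change ∑ i, inner ℝ (p.fst i - p'.fst i) (q.fst i - q'.fst i)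
    + ∑ k, inner ℝ (p.snd k - p'.snd k) (q.snd k - q'.snd k) = _
  ring

theorem isMaximallyMonotone_ktOp (S : CoupledSystem H G)
    (hA : ∀ i, IsMaximallyMonotone (S.A i)) (hB : ∀ k, IsMaximallyMonotone (S.B k)) :
    IsMaximallyMonotone S.ktOp := by
  refine isMaximallyMonotone_of_forall ?_ fun p q h => ?_
  · rintro ⟨p, q⟩ hpq ⟨p', q'⟩ hpq'
    rw [S.inner_sub_kt]
    exact add_nonneg (Finset.sum_nonneg fun i _ => (hA i).1.inner_nonneg (hpq.1 i) (hpq'.1 i))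
      (Finset.sum_nonneg fun k _ => (hB k).1.inner_nonneg (hpq.2 k) (hpq'.2 k))
  · let u : ∀ i, H i := fun i => q.fst i + S.z i - S.Lsumadj p.snd i
    let y : ∀ k, G k := fun k => q.snd k - S.r k + S.Lsum p.fst k
    -- the criterion splits into the criteria for the operators `A i` and `B k`
    have key : ∀ (a : ∀ i, gra (S.A i)) (b : ∀ k, gra (S.B k)),
        0 ≤ ∑ i, inner ℝ (p.fst i - (a i).1.1) (u i - (a i).1.2) +
          ∑ k, inner ℝ (y k - (b k).1.1) (p.snd k - (b k).1.2) := by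
      intro a b
      let p' : KTSpace H G := toKT (fun i => (a i).1.1, fun k => (b k).1.2)
      let q' : KTSpace H G := toKT (fun i => (a i).1.2 - S.z i + S.Lsumadj p'.snd i,
        fun k => (b k).1.1 + S.r k - S.Lsum p'.fst k)
      have e₁ : ∀ i, q'.fst i + S.z i - S.Lsumadj p'.snd i = (a i).1.2 := fun i => by
        change (a i).1.2 - S.z i + S.Lsumadj p'.snd i + S.z i - S.Lsumadj p'.snd i = _
        abel
      have e₂ : ∀ k, q'.snd k - S.r k + S.Lsum p'.fst k = (b k).1.1 := fun k => by
        change (b k).1.1 + S.r k - S.Lsum p'.fst k - S.r k + S.Lsum p'.fst k = _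
        abel
      have h' := h p' q' ⟨fun i => by rw [e₁]; exact (a i).2, fun k => by rw [e₂]; exact (b k).2⟩
      rw [S.inner_sub_kt] at h'
      simp only [e₁, e₂] at h'
      exact h'
    have hA' := fun i => (hA i).exists_inner_nonpos (p.fst i) (u i)
    have hB' := fun k => (hB k).exists_inner_nonpos (y k) (p.snd k)
    choose a₀ ha₀ using hA'
    choose b₀ hb₀ using hB'
    refine ⟨fun i => (hA i).mem_of_forall fun a b hab => ?_,
      fun k => (hB k).mem_of_forall fun a b hab => ?_⟩
    · exact nonneg_of_forall_selection (X := fun i => gra (S.A i))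
        (f := fun i c => inner ℝ (p.fst i - c.1.1) (u i - c.1.2)) (fun i => ⟨_, ha₀ i⟩)
        (fun c => by
          have := key c b₀
          have := Finset.sum_nonpos fun k (_ : k ∈ Finset.univ) => hb₀ k
          linarith) i ⟨(a, b), hab⟩
    · exact nonneg_of_forall_selection (X := fun k => gra (S.B k))
        (f := fun k c => inner ℝ (y k - c.1.1) (p.snd k - c.1.2)) (fun k => ⟨_, hb₀ k⟩)
        (fun c => by
          have := key a₀ c
          have := Finset.sum_nonpos fun i (_ : i ∈ Finset.univ) => ha₀ i
          linarith) k ⟨(a, b), hab⟩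

theorem zero_mem_ktOp_iff (S : CoupledSystem H G) (w : (∀ i, H i) × (∀ k, G k)) :
    (0 : KTSpace H G) ∈ S.ktOp (toKT w) ↔ w ∈ S.kuhnTucker := by
  refine and_congr (forall_congr' fun i => ?_) (forall_congr' fun k => ?_)
  · change (0 : H i) + S.z i - S.Lsumadj w.2 i ∈ S.A i (w.1 i) ↔ _
    rw [zero_add]
    rfl
  · change w.2 k ∈ S.B k ((0 : G k) - S.r k + S.Lsum w.1 k) ↔ w.2 k ∈ S.B k (S.Lsum w.1 k - S.r k)
    rw [zero_sub, neg_add_eq_sub]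

theorem mem_primalSolutions_iff (S : CoupledSystem H G) (x : ∀ i, H i) :
    x ∈ S.primalSolutions ↔ ∃ v, (x, v) ∈ S.kuhnTucker := by
  constructor
  · rintro ⟨u, hu, _, ⟨v, hv, rfl⟩, huv⟩
    refine ⟨v, fun i => ?_, fun k => hv k trivial⟩
    change S.z i - S.Lsumadj v i ∈ S.A i (x i)
    have : S.z i - S.Lsumadj v i = u i := sub_eq_of_eq_add (congrFun huv i).symm
    rw [this]
    exact hu i trivial
  · rintro ⟨v, hx, hv⟩
    exact ⟨S.z - S.Lsumadj v, fun i _ => hx i, S.Lsumadj v, ⟨v, fun k _ => hv k, rfl⟩,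
      sub_add_cancel _ _⟩

theorem mem_dualSolutions_of_mem_kuhnTucker (S : CoupledSystem H G) {x : ∀ i, H i} {v : ∀ k, G k}
    (h : (x, v) ∈ S.kuhnTucker) : v ∈ S.dualSolutions := by
  refine ⟨-S.Lsum x, Set.neg_mem_neg.2 ⟨x, fun i _ => h.1 i, rfl⟩, S.Lsum x - S.r,
    fun k _ => h.2 k, ?_⟩
  change -S.Lsum x + (S.Lsum x - S.r) = -S.r
  abel

/-! ### The iteration as a relaxed projection -/

/-- `(s, t) ∈ M (a, v + μ⁻¹ (l - b))` for the Kuhn-Tucker operator `M`. -/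
theorem step_mem_ktOp (S : CoupledSystem H G)
    (hA : ∀ i, IsMaximallyMonotone (S.A i)) (hB : ∀ k, IsMaximallyMonotone (S.B k))
    {γ μ : ℝ} (hγ : 0 < γ) (hμ : 0 < μ) (w : (∀ i, H i) × (∀ k, G k)) :
    toKT (S.sPt γ μ w, S.tPt γ μ w) ∈ S.ktOp (toKT (S.output γ μ w)) := by
  constructor
  · intro i
    have h := (hA i).resolventMap_smul_mem hγ (w.1 i + γ • (S.z i - S.Lsumadj w.2 i))
    change γ⁻¹ • (w.1 i + γ • (S.z i - S.Lsumadj w.2 i) - S.aPt γ w i) ∈ S.A i (S.aPt γ w i) at h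
    change S.sPt γ μ w i + S.z i - S.Lsumadj (S.output γ μ w).2 i ∈ S.A i (S.aPt γ w i)
    have e : S.sPt γ μ w i + S.z i - S.Lsumadj (S.output γ μ w).2 i
        = γ⁻¹ • (w.1 i + γ • (S.z i - S.Lsumadj w.2 i) - S.aPt γ w i) := by
      have e' : S.Lsumadj (S.output γ μ w).2 i = S.Lsumadj w.2 i
          + μ⁻¹ • ∑ k, ContinuousLinearMap.adjoint (S.L k i) (S.lPt w k - S.bPt μ w k) := by
        simp only [output, Lsumadj, map_add, map_smul, Finset.sum_add_distrib, Finset.smul_sum]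
      rw [e', add_sub_right_comm (w.1 i), smul_add, inv_smul_smul₀ hγ.ne', sPt]
      abel
    rwa [e]
  · intro k
    have h := (hB k).resolventMap_smul_mem hμ (S.lPt w k + μ • w.2 k - S.r k)
    have e : resolventMap (fun y => μ • S.B k y) (S.lPt w k + μ • w.2 k - S.r k)
        = S.bPt μ w k - S.r k := (add_sub_cancel_left _ _).symm
    rw [e] at h
    change w.2 k + μ⁻¹ • (S.lPt w k - S.bPt μ w k) ∈
      S.B k (S.bPt μ w k - S.Lsum (S.aPt γ w) k - S.r k + S.Lsum (S.aPt γ w) k)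
    have e₁ : μ⁻¹ • (S.lPt w k + μ • w.2 k - S.r k - (S.bPt μ w k - S.r k))
        = w.2 k + μ⁻¹ • (S.lPt w k - S.bPt μ w k) := by
      rw [sub_sub_sub_cancel_right, add_sub_right_comm, smul_add, inv_smul_smul₀ hμ.ne', add_comm]
    have e₂ : S.bPt μ w k - S.Lsum (S.aPt γ w) k - S.r k + S.Lsum (S.aPt γ w) k
        = S.bPt μ w k - S.r k := by abel
    rwa [e₂, ← e₁]

theorem norm_sq_step (S : CoupledSystem H G) (γ μ : ℝ) (w : (∀ i, H i) × (∀ k, G k)) :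
    ‖toKT (S.sPt γ μ w, S.tPt γ μ w)‖ ^ 2 = S.tau γ μ w :=
  norm_sq_kt _

/-- The violation of the separating half-space by the current point. -/
noncomputable def gap (S : CoupledSystem H G) (γ μ : ℝ) (w : (∀ i, H i) × (∀ k, G k)) : ℝ :=
  γ⁻¹ * ∑ i, ‖w.1 i - S.aPt γ w i‖ ^ 2 + μ⁻¹ * ∑ k, ‖S.lPt w k - S.bPt μ w k‖ ^ 2

theorem toKT_sub_output (S : CoupledSystem H G) (γ μ : ℝ) (w : (∀ i, H i) × (∀ k, G k)) :
    toKT w - toKT (S.output γ μ w) = toKT (fun i => w.1 i - S.aPt γ w i,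
      fun k => -(μ⁻¹ • (S.lPt w k - S.bPt μ w k))) := by
  have : ∀ k, w.2 k - (w.2 k + μ⁻¹ • (S.lPt w k - S.bPt μ w k))
      = -(μ⁻¹ • (S.lPt w k - S.bPt μ w k)) := fun k => sub_add_cancel_left _ _
  simp only [← this]
  rfl

theorem tPt_eq (S : CoupledSystem H G) (γ μ : ℝ) (w : (∀ i, H i) × (∀ k, G k)) (k : Fin K) :
    S.tPt γ μ w k = S.Lsum (fun i => w.1 i - S.aPt γ w i) k - (S.lPt w k - S.bPt μ w k) := by
  rw [show S.Lsum (fun i => w.1 i - S.aPt γ w i) k = S.lPt w k - S.Lsum (S.aPt γ w) k from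
    S.Lsum_sub _ _ k]
  change S.bPt μ w k - S.Lsum (S.aPt γ w) k = _
  abel

theorem inner_step_eq_gap (S : CoupledSystem H G) (γ μ : ℝ) (w : (∀ i, H i) × (∀ k, G k)) :
    inner ℝ (toKT w - toKT (S.output γ μ w)) (toKT (S.sPt γ μ w, S.tPt γ μ w))
      = S.gap γ μ w := by
  rw [toKT_sub_output, inner_kt]
  set d : ∀ i, H i := fun i => w.1 i - S.aPt γ w i with hd
  set e : ∀ k, G k := fun k => S.lPt w k - S.bPt μ w k with he
  have h := S.sum_inner_Lsum d e
  change ∑ i, inner ℝ (d i) (γ⁻¹ • d i + μ⁻¹ • S.Lsumadj e i)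
    + ∑ k, inner ℝ (-(μ⁻¹ • e k)) (S.tPt γ μ w k)
      = γ⁻¹ * ∑ i, ‖d i‖ ^ 2 + μ⁻¹ * ∑ k, ‖e k‖ ^ 2
  have ht : ∀ k, S.tPt γ μ w k = S.Lsum d k - e k := S.tPt_eq γ μ w
  simp only [ht, inner_add_right, inner_smul_right, inner_neg_left, real_inner_smul_left,
    inner_sub_right, real_inner_self_eq_norm_sq, Finset.sum_add_distrib, Finset.sum_neg_distrib,
    ← Finset.mul_sum, Finset.sum_sub_distrib, h]
  ring

/-- As long as the parameters stay in `[ε, 1 / ε]`, the gap controls all the residuals. -/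
theorem exists_le_gap (S : CoupledSystem H G) {ε : ℝ} (hε : 0 < ε) :
    ∃ C, 0 < C ∧ ∀ γ ∈ Set.Icc ε (1 / ε), ∀ μ ∈ Set.Icc ε (1 / ε), ∀ w,
      S.tau γ μ w ≤ C * S.gap γ μ w ∧
      ‖toKT w - toKT (S.output γ μ w)‖ ^ 2 ≤ C * S.gap γ μ w ∧
      ∑ i, ‖w.1 i - S.aPt γ w i‖ ^ 2 ≤ C * S.gap γ μ w ∧
      ∑ k, ‖S.lPt w k - S.bPt μ w k‖ ^ 2 ≤ C * S.gap γ μ w := by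
  obtain ⟨C₁, hC₁, h₁⟩ := exists_sum_norm_sq_le S.L
  obtain ⟨C₂, hC₂, h₂⟩ :=
    exists_sum_norm_sq_le fun i k => ContinuousLinearMap.adjoint (S.L k i)
  set η := 1 / ε with hη
  have hη0 : 0 < η := by positivity
  -- a crude bound for all the coefficients of `∑ ‖d i‖²` and `∑ ‖e k‖²` that occur below
  refine ⟨(2 * η ^ 2 + 2 * C₁ + 2 + 2 * η ^ 2 * C₂ + 1 + η ^ 2) * η, by positivity,
    fun γ hγ μ hμ w => ?_⟩
  have hγ0 : 0 < γ := hε.trans_le hγ.1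
  have hμ0 : 0 < μ := hε.trans_le hμ.1
  have hγi : γ⁻¹ ≤ η := by rw [hη, one_div]; exact inv_anti₀ hε hγ.1
  have hμi : μ⁻¹ ≤ η := by rw [hη, one_div]; exact inv_anti₀ hε hμ.1
  have hγi0 : 0 < γ⁻¹ := inv_pos.2 hγ0
  have hμi0 : 0 < μ⁻¹ := inv_pos.2 hμ0
  have hγη : 1 ≤ η * γ⁻¹ := by rw [← div_eq_mul_inv, one_le_div hγ0]; exact hγ.2
  have hμη : 1 ≤ η * μ⁻¹ := by rw [← div_eq_mul_inv, one_le_div hμ0]; exact hμ.2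
  have hγ2 : γ⁻¹ ^ 2 ≤ η ^ 2 := pow_le_pow_left₀ hγi0.le hγi 2
  have hμ2 : μ⁻¹ ^ 2 ≤ η ^ 2 := pow_le_pow_left₀ hμi0.le hμi 2
  set d : ∀ i, H i := fun i => w.1 i - S.aPt γ w i with hd
  set e : ∀ k, G k := fun k => S.lPt w k - S.bPt μ w k with he
  set D := ∑ i, ‖d i‖ ^ 2 with hD
  set F := ∑ k, ‖e k‖ ^ 2 with hF
  have hD0 : 0 ≤ D := by positivity
  have hF0 : 0 ≤ F := by positivity
  have hgap : D + F ≤ η * S.gap γ μ w := by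
    change D + F ≤ η * (γ⁻¹ * D + μ⁻¹ * F)
    nlinarith [mul_le_mul_of_nonneg_right hγη hD0, mul_le_mul_of_nonneg_right hμη hF0]
  have hs : ∑ i, ‖S.sPt γ μ w i‖ ^ 2 ≤ 2 * (γ⁻¹ ^ 2 * D + μ⁻¹ ^ 2 * (C₂ * F)) := by
    refine le_trans
      (Finset.sum_le_sum fun i _ => norm_add_sq_le (γ⁻¹ • d i) (μ⁻¹ • S.Lsumadj e i)) ?_
    simp only [norm_smul, mul_pow, Real.norm_eq_abs, sq_abs, ← Finset.mul_sum,
      Finset.sum_add_distrib]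
    have := mul_le_mul_of_nonneg_left (h₂ e) (sq_nonneg μ⁻¹)
    change μ⁻¹ ^ 2 * ∑ i, ‖S.Lsumadj e i‖ ^ 2 ≤ _ at this
    linarith
  have ht : ∑ k, ‖S.tPt γ μ w k‖ ^ 2 ≤ 2 * (C₁ * D + F) := by
    refine le_trans (Finset.sum_le_sum fun k _ => ?_)
      (b := ∑ k, 2 * (‖S.Lsum d k‖ ^ 2 + ‖e k‖ ^ 2)) ?_
    · rw [S.tPt_eq, ← norm_neg (S.lPt w k - S.bPt μ w k), sub_eq_add_neg]
      exact norm_add_sq_le _ _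
    · simp only [← Finset.mul_sum, Finset.sum_add_distrib]
      have := h₁ d
      change ∑ k, ‖S.Lsum d k‖ ^ 2 ≤ _ at this
      linarith
  have hout : ‖toKT w - toKT (S.output γ μ w)‖ ^ 2 = D + μ⁻¹ ^ 2 * F := by
    rw [toKT_sub_output, norm_sq_kt]
    change D + ∑ k, ‖-(μ⁻¹ • e k)‖ ^ 2 = _
    simp only [norm_neg, norm_smul, mul_pow, Real.norm_eq_abs, sq_abs, ← Finset.mul_sum, hF]
  set c := 2 * η ^ 2 + 2 * C₁ + 2 + 2 * η ^ 2 * C₂ + 1 + η ^ 2 with hc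
  have hη2 : 0 ≤ η ^ 2 := sq_nonneg η
  have hηC : 0 ≤ η ^ 2 * C₂ := mul_nonneg hη2 hC₂
  have hgap' : c * (D + F) ≤ c * η * S.gap γ μ w := by
    rw [mul_assoc]
    exact mul_le_mul_of_nonneg_left hgap (by linarith)
  have b₁ := mul_le_mul_of_nonneg_right hγ2 hD0
  have b₂ := mul_le_mul_of_nonneg_right hμ2 hF0
  have b₃ := mul_le_mul_of_nonneg_right hμ2 (mul_nonneg hC₂ hF0)
  have hcle : ∀ α β : ℝ, α ≤ c → β ≤ c → α * D + β * F ≤ c * η * S.gap γ μ w := by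
    intro α β hα hβ
    have := mul_le_mul_of_nonneg_right hα hD0
    have := mul_le_mul_of_nonneg_right hβ hF0
    linarith
  refine ⟨?_, ?_, ?_, ?_⟩
  · have := hcle (2 * η ^ 2 + 2 * C₁) (2 * (η ^ 2 * C₂) + 2) (by linarith) (by linarith)
    unfold tau
    linarith
  · have := hcle 1 (η ^ 2) (by linarith) (by linarith)
    linarith
  · simpa using hcle 1 0 (by linarith) (by linarith)
  · simpa using hcle 0 1 (by linarith) (by linarith)

end CoupledSystem

end MonotoneInclusion

/-! ### Convergence of the algorithm -/

theorem mainTheorem1 {m K : ℕ} (hm : 0 < m) (hK : 0 < K)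
    {H : Fin m → Type*} {G : Fin K → Type*}
    [∀ i, NormedAddCommGroup (H i)] [∀ i, InnerProductSpace ℝ (H i)]
    [∀ i, CompleteSpace (H i)]
    [∀ k, NormedAddCommGroup (G k)] [∀ k, InnerProductSpace ℝ (G k)]
    [∀ k, CompleteSpace (G k)]
    (S : MonotoneInclusion.CoupledSystem H G)
    (hA : ∀ i, MonotoneInclusion.IsMaximallyMonotone (S.A i))
    (hB : ∀ k, MonotoneInclusion.IsMaximallyMonotone (S.B k))
    (hP : S.primalSolutions.Nonempty)
    (ε : ℝ) (hε : ε ∈ Set.Ioo (0 : ℝ) 1)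
    (x₀ : ∀ i, H i) (v₀ : ∀ k, G k)
    (γ μ lam : ℕ → ℝ)
    (hγ : ∀ n, γ n ∈ Set.Icc ε (1 / ε)) (hμ : ∀ n, μ n ∈ Set.Icc ε (1 / ε))
    (hlam : ∀ n, lam n ∈ Set.Icc ε (2 - ε))
    (w : ℕ → (∀ i, H i) × (∀ k, G k)) (hw : w = S.iter γ μ lam (x₀, v₀)) :
    -- the algorithm stops at iteration `N` and returns a Kuhn-Tucker point
    (∃ N, (∀ n < N, 0 < S.tau (γ n) (μ n) (w n)) ∧ S.tau (γ N) (μ N) (w N) = 0 ∧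
      S.output (γ N) (μ N) (w N) ∈ S.kuhnTucker) ∨
    -- or it never stops
    ((∀ n, 0 < S.tau (γ n) (μ n) (w n)) ∧
      (∀ i,
        Summable (fun n => ‖S.sPt (γ n) (μ n) (w n) i‖ ^ 2) ∧
        Summable (fun n => ‖(w (n + 1)).1 i - (w n).1 i‖ ^ 2) ∧
        Summable (fun n => ‖(w n).1 i - S.aPt (γ n) (w n) i‖ ^ 2)) ∧
      (∀ k,
        Summable (fun n => ‖S.tPt (γ n) (μ n) (w n) k‖ ^ 2) ∧
        Summable (fun n => ‖(w (n + 1)).2 k - (w n).2 k‖ ^ 2) ∧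
        Summable (fun n => ‖∑ i, S.L k i ((w n).1 i) - S.bPt (μ n) (w n) k‖ ^ 2)) ∧
      ∃ (xbar : ∀ i, H i) (vbar : ∀ k, G k),
        (∀ i, MonotoneInclusion.WeaklyConverges (fun n => (w n).1 i) (xbar i)) ∧
        (∀ k, MonotoneInclusion.WeaklyConverges (fun n => (w n).2 k) (vbar k)) ∧
        xbar ∈ S.primalSolutions ∧ vbar ∈ S.dualSolutions ∧
        (xbar, vbar) ∈ S.kuhnTucker) := by
  obtain ⟨hε0, -⟩ := hε
  have hγ0 : ∀ n, 0 < γ n := fun n => hε0.trans_le (hγ n).1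
  have hμ0 : ∀ n, 0 < μ n := fun n => hε0.trans_le (hμ n).1
  have hM := S.isMaximallyMonotone_ktOp hA hB
  have hmem := fun n => S.step_mem_ktOp hA hB (hγ0 n) (hμ0 n) (w n)
  have hτ0 : ∀ n, 0 ≤ S.tau (γ n) (μ n) (w n) := fun n => by
    rw [← S.norm_sq_step]; positivity
  by_cases hterm : ∃ N, S.tau (γ N) (μ N) (w N) = 0
  · classical
    refine Or.inl ⟨Nat.find hterm, fun n hn => (hτ0 n).lt_of_ne' (Nat.find_min hterm hn),
      Nat.find_spec hterm, ?_⟩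
    have h := hmem (Nat.find hterm)
    have h0 := Nat.find_spec hterm
    rw [← S.norm_sq_step, sq_eq_zero_iff, norm_eq_zero] at h0
    rwa [h0, S.zero_mem_ktOp_iff] at h
  · rw [not_exists] at hterm
    have hτ : ∀ n, 0 < S.tau (γ n) (μ n) (w n) := fun n => (hτ0 n).lt_of_ne' (hterm n)
    obtain ⟨C, hC, hgap⟩ := S.exists_le_gap hε0
    have hgap' := fun n => hgap (γ n) (hγ n) (μ n) (hμ n) (w n)
    have hZ : ∃ p, (0 : MonotoneInclusion.CoupledSystem.KTSpace H G) ∈ S.ktOp p := by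
      obtain ⟨x, hx⟩ := hP
      obtain ⟨v, hv⟩ := (S.mem_primalSolutions_iff x).1 hx
      exact ⟨_, (S.zero_mem_ktOp_iff (x, v)).2 hv⟩
    obtain ⟨hδ, hdiff, p, hp, hconv⟩ := hM.halfspace_projection_converges hZ hε0 hC hlam
      (w := fun n => MonotoneInclusion.CoupledSystem.toKT (w n)) hmem
      (fun n h => (hτ n).ne' (by rw [← S.norm_sq_step, h]; simp))
      (fun n => S.inner_step_eq_gap (γ n) (μ n) (w n))
      (fun n => (S.norm_sq_step _ _ _).trans_le (hgap' n).1) (fun n => (hgap' n).2.1)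
      (fun n => by
        subst hw
        rw [S.norm_sq_step]
        rfl)
    have hCδ := hδ.mul_left C
    -- passage from the summability of the squared norm of a tuple to that of its components
    have hdom : ∀ {ι : Type} [Fintype ι] (f : ℕ → ι → ℝ), (∀ n i, 0 ≤ f n i) →
        (Summable fun n => ∑ i, f n i) → ∀ i, Summable fun n => f n i :=
      fun f hf h i => Summable.of_nonneg_of_le (fun n => hf n i) (fun n =>
        Finset.single_le_sum (f := f n) (fun j _ => hf n j) (Finset.mem_univ i)) h
    have hτsum : Summable fun n => S.tau (γ n) (μ n) (w n) :=
      Summable.of_nonneg_of_le hτ0 (fun n => (hgap' n).1) hCδ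
    have hdiff' : Summable fun n => ∑ i, ‖(w (n + 1)).1 i - (w n).1 i‖ ^ 2
        + ∑ k, ‖(w (n + 1)).2 k - (w n).2 k‖ ^ 2 :=
      hdiff.congr fun n => MonotoneInclusion.CoupledSystem.norm_sq_kt _
    have hkt : (p.fst.ofLp, p.snd.ofLp) ∈ S.kuhnTucker := (S.zero_mem_ktOp_iff _).1 hp
    refine Or.inr ⟨hτ, fun i => ⟨?_, ?_, ?_⟩, fun k => ⟨?_, ?_, ?_⟩, p.fst.ofLp, p.snd.ofLp,
      fun i => ?_, fun k => ?_, (S.mem_primalSolutions_iff _).2 ⟨_, hkt⟩,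
      S.mem_dualSolutions_of_mem_kuhnTucker hkt, hkt⟩
    · refine hdom (fun n i => ‖S.sPt (γ n) (μ n) (w n) i‖ ^ 2) (fun n i => sq_nonneg _)
        (Summable.of_nonneg_of_le (fun n => by positivity) (fun n => ?_) hτsum) i
      exact le_add_of_nonneg_right (by positivity)
    · refine hdom (fun n i => ‖(w (n + 1)).1 i - (w n).1 i‖ ^ 2) (fun n i => sq_nonneg _)
        (Summable.of_nonneg_of_le (fun n => by positivity) (fun n => ?_) hdiff') i
      exact le_add_of_nonneg_right (by positivity)
    · exact hdom (fun n i => ‖(w n).1 i - S.aPt (γ n) (w n) i‖ ^ 2) (fun n i => sq_nonneg _)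
        (Summable.of_nonneg_of_le (fun n => by positivity) (fun n => (hgap' n).2.2.1) hCδ) i
    · refine hdom (fun n k => ‖S.tPt (γ n) (μ n) (w n) k‖ ^ 2) (fun n k => sq_nonneg _)
        (Summable.of_nonneg_of_le (fun n => by positivity) (fun n => ?_) hτsum) k
      exact le_add_of_nonneg_left (by positivity)
    · refine hdom (fun n k => ‖(w (n + 1)).2 k - (w n).2 k‖ ^ 2) (fun n k => sq_nonneg _)
        (Summable.of_nonneg_of_le (fun n => by positivity) (fun n => ?_) hdiff') k
      exact le_add_of_nonneg_left (by positivity)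
    · exact hdom (fun n k => ‖S.lPt (w n) k - S.bPt (μ n) (w n) k‖ ^ 2) (fun n k => sq_nonneg _)
        (Summable.of_nonneg_of_le (fun n => by positivity) (fun n => (hgap' n).2.2.2) hCδ) k
    · exact hconv.map ((PiLp.proj 2 H i).comp (WithLp.fstL 2 ℝ _ _))
    · exact hconv.map ((PiLp.proj 2 G k).comp (WithLp.sndL 2 ℝ _ _))
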